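/- Let $A\in\mathbb R^{n\times n}$ ($n\ge 1$) be symmetric positive definite (SPD). Write $\|\cdot\|$ for the Euclidean vector norm and the induced matrix (spectral) norm, and $\|u\|_A=(u^TAu)^{1/2}$, with induced matrix norm $\|E\|_A=\max_{u\ne 0}\|Eu\|_A/\|u\|_A$. A CF-splitting of the unknowns into F-points and $n_c$ C-points partitions $A=\begin{bmatrix}A_{ff}&A_{fc}\\A_{cf}&A_{cc}\end{bmatrix}$; for $u\in\mathbb R^n$, $u_c$ is the restriction of $u$ to the C-points. For $P=\begin{bmatrix}W\\I\end{bmatrix}\in\mathbb R^{n\times n_c}$, with an arbitrary real matrix $W$, let $$\hat\mu(P)=\hat\mu_A(P):=\max_{u\ne0}\frac{\|u-Pu_c\|_A^2}{\|Au\|^2}.$$ This maximum is attained. **Multigrid bound.** Consider a multigrid hierarchy: $A_0=A$; on each level $\ell<L$ a CF-splitting, an interpolation $P_\ell=\begin{bmatrix}W_\ell\\I\end{bmatrix}$, a smoother $M_\ell$ (relaxation $x\leftarrow x+M_\ell^{-1}r$), and $A_{\ell+1}=P_\ell^TA_\ell P_\ell$. The error propagation of the symmetric V(1,1)-cycle with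 exact coarsest solve is given by $E_L=0$ and $$E_\ell=(I-M_\ell^{-T}A_\ell)\bigl(I-P_\ell(I-E_{\ell+1})A_{\ell+1}^{-1}P_\ell^TA_\ell\bigr)(I-M_\ell^{-1}A_\ell),$$ $E_{MG}=E_0$, and $K_{MG}$ is defined by $\|E_{MG}\|_A=1-1/K_{MG}$. (a) If on every level $\ell<L$ the smoother is convergent in the energy norm, i.e. $M_\ell+M_\ell^T-A_\ell$ is SPD, then $\|E_{MG}\|_A<1$ and $$1\le K_{MG}\le 1+\max_{\ell<L}\hat\mu_{A_\ell}(P_\ell)\,\|\widetilde M_\ell\|,\qquad \widetilde M_\ell=M_\ell^T(M_\ell+M_\ell^T-A_\ell)^{-1}M_\ell .$$ (b) If on every level $\ell<L$ the smoother $M_\ell$ is SPD and $M_\ell-A_\ell$ is positive semidefinite, then $\|E_{MG}\|_A<1$ and $$1\le K_{MG}\le 1+\max_{\ell<L}\hat\mu_{A_\ell}(P_\ell)\,\|M_\ell\| .$$ (For two levels the maximum has a single term, so (b) reads $K_{MG}\le1+\hat\mu(P)\|M\|$; if $L=0$ the maximum is $0$.) **Optimal interpolation.** For every CF-splitting, $A_{ff}^2+A_{fc}A_{cf}$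 is invertible, and among all $P$ of the form $\begin{bmatrix}W\\I\end{bmatrix}$ the minimum of $\hat\mu$ is attained at $$P=\begin{bmatrix}-(A_{ff}^2+A_{fc}A_{cf})^{-1}(A_{ff}A_{fc}+A_{fc}A_{cc})\\ I\end{bmatrix},$$ which is exactly the ideal interpolation $\begin{bmatrix}-B_{ff}^{-1}B_{fc}\\I\end{bmatrix}$ for $B=A^2$. -/

import Mathlib

open Matrix

universe u

noncomputable section

/-- The `A`-norm (energy norm) of a vector, `‖x‖_A = √(xᵀ A x)`. -/
def energyNorm {n : Type u} [Fintype n] (A : Matrix n n ℝ) (x : n → ℝ) : ℝ :=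
  Real.sqrt (x ⬝ᵥ (A *ᵥ x))

/-- The operator norm of `E` induced by the `A`-norm of vectors,
`‖E‖_A = sup_{x ≠ 0} ‖E x‖_A / ‖x‖_A`. -/
def energyOpNorm {n : Type u} [Fintype n] (A E : Matrix n n ℝ) : ℝ :=
  sSup {r : ℝ | ∃ x : n → ℝ, x ≠ 0 ∧ r = energyNorm A (E *ᵥ x) / energyNorm A x}

/-- The Euclidean (`ℓ²`) norm of a vector. -/
def l2Norm {n : Type u} [Fintype n] (x : n → ℝ) : ℝ :=
  ‖WithLp.toLp 2 x‖

/-- The spectral norm of a matrix, i.e. the operator norm induced by the Euclidean norm. -/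
def spectralNorm2 {n : Type u} [Fintype n] [DecidableEq n] (M : Matrix n n ℝ) : ℝ :=
  ‖Matrix.toEuclideanCLM (n := n) (𝕜 := ℝ) M‖

/-! A CF-splitting of the index set `n` is the choice of the finset `C` of C-points;
its complement is the set of F-points. -/

/-- F-F block. -/
def blockFF {n : Type u} (C : Finset n) (A : Matrix n n ℝ) :
    Matrix {i // i ∉ C} {i // i ∉ C} ℝ :=
  A.submatrix Subtype.val Subtype.val

/-- F-C block. -/
def blockFC {n : Type u} (C : Finset n) (A : Matrix n n ℝ) :
    Matrix {i // i ∉ C} {i // i ∈ C} ℝ :=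
  A.submatrix Subtype.val Subtype.val

/-- C-F block. -/
def blockCF {n : Type u} (C : Finset n) (A : Matrix n n ℝ) :
    Matrix {i // i ∈ C} {i // i ∉ C} ℝ :=
  A.submatrix Subtype.val Subtype.val

/-- C-C block. -/
def blockCC {n : Type u} (C : Finset n) (A : Matrix n n ℝ) :
    Matrix {i // i ∈ C} {i // i ∈ C} ℝ :=
  A.submatrix Subtype.val Subtype.val

/-- The interpolation operator `P = [W; I]`: the rows of the F-points are those of `W`, and the
C-points are interpolated by injection. -/
def interpolation {n : Type u} [DecidableEq n] (C : Finset n)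
    (W : Matrix {i // i ∉ C} {i // i ∈ C} ℝ) : Matrix n {i // i ∈ C} ℝ :=
  Matrix.of fun i j =>
    if h : i ∈ C then (1 : Matrix {i // i ∈ C} {i // i ∈ C} ℝ) ⟨i, h⟩ j else W ⟨i, h⟩ j

/-- Ideal interpolation `[-B_ff⁻¹ B_fc; I]` for the matrix `B`. -/
def idealInterpolation {n : Type u} [Fintype n] [DecidableEq n] (C : Finset n)
    (B : Matrix n n ℝ) : Matrix n {i // i ∈ C} ℝ :=
  interpolation C (-((blockFF C B)⁻¹ * blockFC C B))

/-- The set of the quotients `‖u - P u_c‖_A² / ‖A u‖²`, `u ≠ 0`, where `u_c` is the restriction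
of `u` to the C-points. -/
def muHatSet {n : Type u} [Fintype n] [DecidableEq n] (A : Matrix n n ℝ) (C : Finset n)
    (P : Matrix n {i // i ∈ C} ℝ) : Set ℝ :=
  {r : ℝ | ∃ x : n → ℝ, x ≠ 0 ∧
    r = energyNorm A (x - P *ᵥ (fun j : {i // i ∈ C} => x j)) ^ 2 / l2Norm (A *ᵥ x) ^ 2}

/-- The measure `μ̂(P) = max_{u ≠ 0} ‖u - P u_c‖_A² / ‖A u‖²`. -/
def muHat {n : Type u} [Fintype n] [DecidableEq n] (A : Matrix n n ℝ) (C : Finset n)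
    (P : Matrix n {i // i ∈ C} ℝ) : ℝ :=
  sSup (muHatSet A C P)

/-- The symmetrized smoother `M̃ = Mᵀ (M + Mᵀ - A)⁻¹ M`. It satisfies
`I - M̃⁻¹ A = (I - M⁻¹ A) (I - M⁻ᵀ A)`. -/
def symmetrizedSmoother {n : Type u} [Fintype n] [DecidableEq n] (A M : Matrix n n ℝ) :
    Matrix n n ℝ :=
  Mᵀ * (M + Mᵀ - A)⁻¹ * M

/-- A multigrid hierarchy below a grid with index set `n`: either `n` is the coarsest grid, or
there are a CF-splitting of `n` with C-points `C`, the block `W` of the interpolation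
`P = [W; I]`, a smoother `M` (relaxation `x ← x + M⁻¹ r`), and a hierarchy below the next coarser
grid, whose index set is `C`. The coarse-grid matrices are not data: they are the Galerkin
products `Pᵀ A P` of the matrix `A` given on the finest grid. -/
inductive Hierarchy : Type u → Type (u + 1)
  | coarsest {n : Type u} : Hierarchy n
  | level {n : Type u} (C : Finset n) (W : Matrix {i // i ∉ C} {i // i ∈ C} ℝ)
      (M : Matrix n n ℝ) (next : Hierarchy {i // i ∈ C}) : Hierarchy n

namespace Hierarchy

/-- The Galerkin coarse-grid matrix `Pᵀ A P` with `P = [W; I]`. -/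
def galerkin {n : Type u} [Fintype n] [DecidableEq n] (A : Matrix n n ℝ) (C : Finset n)
    (W : Matrix {i // i ∉ C} {i // i ∈ C} ℝ) : Matrix {i // i ∈ C} {i // i ∈ C} ℝ :=
  (interpolation C W)ᵀ * A * interpolation C W

/-- Error propagation matrix `E_MG` of the symmetric V(1,1)-cycle for `A`: relax once with `M`,
restrict the residual by `Pᵀ`, apply one cycle of the next coarser level (with zero initial
guess) to the Galerkin problem, interpolate the correction by `P`, relax once with `Mᵀ`. The
problem on the coarsest grid is solved exactly. With `A_c = Pᵀ A P` and the coarse error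
propagation `E_c`, the coarse cycle maps a right-hand side `b_c` to `(I - E_c) A_c⁻¹ b_c`. -/
def errorMG : {n : Type u} → [Fintype n] → [DecidableEq n] → Hierarchy n →
    Matrix n n ℝ → Matrix n n ℝ
  | _, _, _, coarsest, _ => 0
  | _, _, _, level C W M next, A =>
      (1 - (Mᵀ)⁻¹ * A) *
      (1 - interpolation C W * ((1 - errorMG next (galerkin A C W)) * (galerkin A C W)⁻¹) *
        (interpolation C W)ᵀ * A) *
      (1 - M⁻¹ * A)

/-- The constant `K_MG`, defined by `‖E_MG‖_A = 1 - 1 / K_MG`. -/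
def KMG {n : Type u} [Fintype n] [DecidableEq n] (H : Hierarchy n) (A : Matrix n n ℝ) : ℝ :=
  1 / (1 - energyOpNorm A (H.errorMG A))

/-- On every level but the coarsest, `M_ℓ + M_ℓᵀ - A_ℓ` is SPD, that is, the
relaxation is convergent in the `A_ℓ`-norm: `‖I - M_ℓ⁻¹ A_ℓ‖_{A_ℓ} < 1`. -/
def ConvergentSmoothers : {n : Type u} → [Fintype n] → [DecidableEq n] → Hierarchy n →
    Matrix n n ℝ → Prop
  | _, _, _, coarsest, _ => True
  | _, _, _, level C W M next, A =>
      (M + Mᵀ - A).PosDef ∧ ConvergentSmoothers next (galerkin A C W)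

/-- On every level but the coarsest, `M_ℓ` is SPD and `M_ℓ - A_ℓ` is positive semidefinite. -/
def ScaledSPDSmoothers : {n : Type u} → [Fintype n] → [DecidableEq n] → Hierarchy n →
    Matrix n n ℝ → Prop
  | _, _, _, coarsest, _ => True
  | _, _, _, level C W M next, A =>
      (M.PosDef ∧ (M - A).PosSemidef) ∧ ScaledSPDSmoothers next (galerkin A C W)

/-- `max_ℓ μ̂_{A_ℓ}(P_ℓ) ‖M_ℓ‖` over all levels but the coarsest (`0` if there are none). -/
def maxMuHat : {n : Type u} → [Fintype n] → [DecidableEq n] → Hierarchy n →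
    Matrix n n ℝ → ℝ
  | _, _, _, coarsest, _ => 0
  | _, _, _, level C W M next, A =>
      max (muHat A C (interpolation C W) * spectralNorm2 M) (maxMuHat next (galerkin A C W))

/-- `max_ℓ μ̂_{A_ℓ}(P_ℓ) ‖M̃_ℓ‖` over all levels but the coarsest (`0` if there are none), where
`M̃_ℓ` is the symmetrized smoother. -/
def maxMuHatSymm : {n : Type u} → [Fintype n] → [DecidableEq n] → Hierarchy n →
    Matrix n n ℝ → ℝ
  | _, _, _, coarsest, _ => 0
  | _, _, _, level C W M next, A =>
      max (muHat A C (interpolation C W) * spectralNorm2 (symmetrizedSmoother A M))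
        (maxMuHatSymm next (galerkin A C W))

end Hierarchy

end

/-!
The multigrid bound rests on one energy estimate per level. Let `G = I - M⁻¹ A`, let `e = G x` be
the error after relaxation, and let `T` be the `A`-orthogonal projection that removes the range of
`P`, so that `T e` is the error left by an exact coarse solve. Since `T e` is the best correction,
`‖T e‖_A² ≤ ‖e - P e_c‖_A² ≤ μ̂ ‖A e‖²`. With `w = M⁻¹ A x` one has `A e = (M - A) w`, and the
energy lost by relaxation is `‖x‖_A² - ‖e‖_A² = wᵀ (M + Mᵀ - A) w`. So a smoothing estimate
`μ̂ ‖(M - A) w‖² ≤ c wᵀ (M + Mᵀ - A) w` gives `‖T e‖_A² ≤ c (‖x‖_A² - ‖e‖_A²)`. The constants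
`‖M̃‖` and `‖M‖` in the smoothing estimate are supplied by `residual_le_symmetrizedSmoother`, from
`(M - A) (M + Mᵀ - A)⁻¹ (M - A)ᵀ = M̃ - A`, and by `residual_le_spectralNorm2`.

If the coarse-grid cycle satisfies `0 ≤ E_c ≤ d` in the `A_c`-inner product, then
`⟨E x, x⟩_A ≤ ‖T e‖_A² + d (‖e‖_A² - ‖T e‖_A²)`, and for `d = c / (1 + c)` the estimate above bounds
this by `d ‖x‖_A²`. The bounds `0 ≤ E ≤ d` thus propagate from the coarsest grid, where `E = 0`, to
the finest one (`cycle_bounds`, `Hierarchy.SmoothingBound.errorMG_bounds`). As `E` is self-adjoint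
in the energy inner product, they bound its norm by `d`, which says that `K_MG ≤ 1 + c`.

Optimality of the ideal interpolation for `A²` is a comparison of quotients: its error
`f = u - P u_c` vanishes on the C-points, hence is its own interpolation error for every other
`[W; I]`, and `‖A f‖ ≤ ‖A u‖` because `f` and `P u_c` are orthogonal for `A²`.
-/

namespace Matrix

variable {n : Type u} [Fintype n]

/-! ### Quadratic forms of symmetric matrices -/

lemma IsHermitian.dotProduct_mulVec_comm {A : Matrix n n ℝ} (hA : A.IsHermitian) (x y : n → ℝ) :
    x ⬝ᵥ (A *ᵥ y) = y ⬝ᵥ (A *ᵥ x) := by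
  have h : Aᵀ = A := by simpa using hA.eq
  rw [dotProduct_mulVec, ← mulVec_transpose, h, dotProduct_comm]

lemma PosSemidef.quadForm_nonneg {A : Matrix n n ℝ} (hA : A.PosSemidef) (x : n → ℝ) :
    0 ≤ x ⬝ᵥ (A *ᵥ x) := by
  simpa using hA.dotProduct_mulVec_nonneg x

lemma PosDef.quadForm_pos {A : Matrix n n ℝ} (hA : A.PosDef) {x : n → ℝ} (hx : x ≠ 0) :
    0 < x ⬝ᵥ (A *ᵥ x) := by
  simpa using hA.dotProduct_mulVec_pos hx

/-- The Cauchy–Schwarz inequality for a positive semidefinite form. -/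
lemma PosSemidef.sq_dotProduct_mulVec_le {A : Matrix n n ℝ} (hA : A.PosSemidef) (x y : n → ℝ) :
    (x ⬝ᵥ (A *ᵥ y)) ^ 2 ≤ (x ⬝ᵥ (A *ᵥ x)) * (y ⬝ᵥ (A *ᵥ y)) := by
  have h : ∀ t : ℝ, 0 ≤ (y ⬝ᵥ (A *ᵥ y)) * (t * t) + (2 * (x ⬝ᵥ (A *ᵥ y))) * t +
      x ⬝ᵥ (A *ᵥ x) := fun t => by
    have h := hA.quadForm_nonneg (x + t • y)
    simp only [mulVec_add, mulVec_smul, dotProduct_add, add_dotProduct, smul_dotProduct,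
      dotProduct_smul, smul_eq_mul] at h
    rw [hA.isHermitian.dotProduct_mulVec_comm y x] at h
    linarith
  have := discrim_le_zero h
  rw [discrim] at this
  linarith

/-- Two-sided bounds `0 ≤ xᵀ Q x ≤ d xᵀ A x` give a bound for `A E = Q` in the `A`-norm. -/
lemma PosSemidef.energy_mulVec_le {A E : Matrix n n ℝ} {d : ℝ} (hd : 0 ≤ d) (hA : A.PosDef)
    (hQ : (A * E).PosSemidef) (hQd : (d • A - A * E).PosSemidef) (x : n → ℝ) :
    (E *ᵥ x) ⬝ᵥ (A *ᵥ (E *ᵥ x)) ≤ d ^ 2 * (x ⬝ᵥ (A *ᵥ x)) := by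
  have hle : ∀ z : n → ℝ, z ⬝ᵥ ((A * E) *ᵥ z) ≤ d * (z ⬝ᵥ (A *ᵥ z)) := fun z => by
    have := hQd.quadForm_nonneg z
    rw [sub_mulVec, smul_mulVec, dotProduct_sub, dotProduct_smul, smul_eq_mul] at this
    linarith
  have hcs := hQ.sq_dotProduct_mulVec_le (E *ᵥ x) x
  have h1 := hle (E *ᵥ x)
  have h2 := hle x
  rw [← mulVec_mulVec x] at hcs
  have p0 := hA.posSemidef.quadForm_nonneg (E *ᵥ x)
  have p1 := hQ.quadForm_nonneg (E *ᵥ x)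
  have p2 := hQ.quadForm_nonneg x
  have p3 := hA.posSemidef.quadForm_nonneg x
  rw [← mulVec_mulVec x] at p2 h2
  rcases p0.eq_or_lt with h0 | h0
  · rw [← h0]; positivity
  · have := hcs.trans (mul_le_mul h1 h2 p2 (by positivity))
    rw [sq] at this
    refine le_of_mul_le_mul_left (this.trans (le_of_eq ?_)) h0
    ring

end Matrix

/-! ### Euclidean, energy and operator norms -/

section Norms

variable {n : Type u} [Fintype n]

lemma l2Norm_sq (x : n → ℝ) : l2Norm x ^ 2 = x ⬝ᵥ x := by
  rw [l2Norm, EuclideanSpace.real_norm_sq_eq]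
  simp [dotProduct, sq]

lemma energyNorm_sq {A : Matrix n n ℝ} (hA : A.PosSemidef) (x : n → ℝ) :
    energyNorm A x ^ 2 = x ⬝ᵥ (A *ᵥ x) :=
  Real.sq_sqrt (hA.quadForm_nonneg x)

lemma l2Norm_pos {x : n → ℝ} (hx : x ≠ 0) : 0 < l2Norm x :=
  norm_pos_iff.2 fun h => hx (by simpa using h)

lemma l2Norm_mulVec_pos {A : Matrix n n ℝ} (hA : A.PosDef) {x : n → ℝ} (hx : x ≠ 0) :
    0 < l2Norm (A *ᵥ x) := by
  refine l2Norm_pos fun h => ?_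
  have := hA.quadForm_pos hx
  simp [h] at this

lemma spectralNorm2_nonneg [DecidableEq n] (M : Matrix n n ℝ) : 0 ≤ spectralNorm2 M :=
  norm_nonneg _

lemma dotProduct_mulVec_le_spectralNorm2 [DecidableEq n] (M : Matrix n n ℝ) (y : n → ℝ) :
    y ⬝ᵥ (M *ᵥ y) ≤ spectralNorm2 M * (y ⬝ᵥ y) := by
  rw [← l2Norm_sq]
  have h1 := (Matrix.toEuclideanCLM (n := n) (𝕜 := ℝ) M).le_opNorm (WithLp.toLp 2 y)
  have h2 := real_inner_le_norm (WithLp.toLp 2 y)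
    (Matrix.toEuclideanCLM (n := n) (𝕜 := ℝ) M (WithLp.toLp 2 y))
  rw [Matrix.inner_toEuclideanCLM] at h2
  calc y ⬝ᵥ (M *ᵥ y) ≤ _ := h2
    _ ≤ _ := mul_le_mul_of_nonneg_left h1 (norm_nonneg _)
    _ = _ := by rw [spectralNorm2, l2Norm]; ring

lemma energyOpNorm_nonneg (A E : Matrix n n ℝ) : 0 ≤ energyOpNorm A E := by
  refine Real.sSup_nonneg ?_
  rintro _ ⟨x, -, rfl⟩
  exact div_nonneg (Real.sqrt_nonneg _) (Real.sqrt_nonneg _)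

lemma energyOpNorm_le {A E : Matrix n n ℝ} {d : ℝ} (hd : 0 ≤ d) (hA : A.PosDef)
    (hQ : (A * E).PosSemidef) (hQd : (d • A - A * E).PosSemidef) : energyOpNorm A E ≤ d := by
  refine Real.sSup_le ?_ hd
  rintro _ ⟨x, hx, rfl⟩
  refine div_le_of_le_mul₀ (Real.sqrt_nonneg _) hd (Real.sqrt_le_iff.2
    ⟨mul_nonneg hd (Real.sqrt_nonneg _), ?_⟩)
  rw [mul_pow, energyNorm_sq hA.posSemidef]
  exact Matrix.PosSemidef.energy_mulVec_le hd hA hQ hQd x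

end Norms

/-! ### The measure `μ̂` -/

section MuHat

variable {n : Type u} [Fintype n] [DecidableEq n]

omit [Fintype n] in
lemma interpolation_apply_mem (C : Finset n) (W : Matrix {i // i ∉ C} {i // i ∈ C} ℝ)
    (v : {i // i ∈ C} → ℝ) (j : {i // i ∈ C}) : (interpolation C W *ᵥ v) j = v j := by
  have : (interpolation C W *ᵥ v) j = ((1 : Matrix {i // i ∈ C} {i // i ∈ C} ℝ) *ᵥ v) j := by
    simp only [Matrix.mulVec, dotProduct, interpolation, Matrix.of_apply]
    simp
  rw [this, Matrix.one_mulVec]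

omit [Fintype n] in
lemma interpolation_apply_notMem (C : Finset n) (W : Matrix {i // i ∉ C} {i // i ∈ C} ℝ)
    (v : {i // i ∈ C} → ℝ) (i : {i // i ∉ C}) : (interpolation C W *ᵥ v) i = (W *ᵥ v) i := by
  simp only [Matrix.mulVec, dotProduct, interpolation, Matrix.of_apply]
  simp [i.2]

omit [Fintype n] in
lemma interpolation_injective (C : Finset n) (W : Matrix {i // i ∉ C} {i // i ∈ C} ℝ) :
    Function.Injective (interpolation C W).mulVec := fun v w h => by
  ext j
  rw [← interpolation_apply_mem C W v, ← interpolation_apply_mem C W w, h]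

lemma posDef_galerkin {A : Matrix n n ℝ} (hA : A.PosDef) (C : Finset n)
    (W : Matrix {i // i ∉ C} {i // i ∈ C} ℝ) : (Hierarchy.galerkin A C W).PosDef := by
  have := hA.conjTranspose_mul_mul_same (interpolation_injective C W)
  rwa [Matrix.conjTranspose_eq_transpose_of_trivial] at this

/-- The quotient is continuous and invariant under scaling, so that it attains its maximum on the
compact unit sphere. -/
lemma isGreatest_muHat [Nonempty n] {A : Matrix n n ℝ} (hA : A.PosDef) (C : Finset n)
    (P : Matrix n {i // i ∈ C} ℝ) : IsGreatest (muHatSet A C P) (muHat A C P) := by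
  set f : (n → ℝ) → ℝ := fun x =>
    energyNorm A (x - P *ᵥ (fun j : {i // i ∈ C} => x j)) ^ 2 / l2Norm (A *ᵥ x) ^ 2 with hf
  have hcont : ContinuousOn f (Metric.sphere 0 1) := by
    refine ContinuousOn.div ?_ ?_ ?_
    · refine Continuous.continuousOn ?_
      simp only [energyNorm, Matrix.mulVec, dotProduct]
      fun_prop
    · refine Continuous.continuousOn ?_
      simp only [l2Norm_sq, Matrix.mulVec, dotProduct]
      fun_prop
    · intro x hx
      have hx0 : x ≠ 0 := by rintro rfl; simp at hx
      exact pow_ne_zero _ (l2Norm_mulVec_pos hA hx0).ne'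
  have hhom : ∀ (t : ℝ) (x : n → ℝ), t ≠ 0 → f (t • x) = f x := by
    intro t x ht
    have h1 : t • x - P *ᵥ (fun j : {i // i ∈ C} => (t • x) j) =
        t • (x - P *ᵥ (fun j : {i // i ∈ C} => x j)) := by
      rw [smul_sub, ← Matrix.mulVec_smul]; rfl
    simp only [hf]
    rw [h1, Matrix.mulVec_smul, energyNorm_sq hA.posSemidef, energyNorm_sq hA.posSemidef,
      l2Norm_sq, l2Norm_sq]
    simp only [Matrix.mulVec_smul, smul_dotProduct, dotProduct_smul, smul_eq_mul]
    rw [← mul_assoc, ← mul_assoc]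
    exact mul_div_mul_left _ _ (mul_ne_zero ht ht)
  obtain ⟨x₀, hx₀, hmax⟩ := (isCompact_sphere (0 : n → ℝ) 1).exists_isMaxOn
    (NormedSpace.sphere_nonempty.2 zero_le_one) hcont
  have hG : IsGreatest (muHatSet A C P) (f x₀) := by
    refine ⟨⟨x₀, by rintro rfl; simp at hx₀, rfl⟩, ?_⟩
    rintro _ ⟨x, hx, rfl⟩
    have hn : ‖x‖ ≠ 0 := norm_ne_zero_iff.2 hx
    have := hmax (show ‖x‖⁻¹ • x ∈ Metric.sphere (0 : n → ℝ) 1 by simp [norm_smul, hn])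
    rw [Set.mem_ofPred_eq, hhom _ _ (inv_ne_zero hn)] at this
    exact this
  rwa [muHat, hG.csSup_eq]

lemma muHat_nonneg (A : Matrix n n ℝ) (C : Finset n) (P : Matrix n {i // i ∈ C} ℝ) :
    0 ≤ muHat A C P := by
  refine Real.sSup_nonneg ?_
  rintro _ ⟨x, -, rfl⟩
  positivity

lemma energy_le_muHat {A : Matrix n n ℝ} (hA : A.PosDef) (C : Finset n)
    (P : Matrix n {i // i ∈ C} ℝ) (x : n → ℝ) :
    energyNorm A (x - P *ᵥ (fun j : {i // i ∈ C} => x j)) ^ 2 ≤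
      muHat A C P * ((A *ᵥ x) ⬝ᵥ (A *ᵥ x)) := by
  rcases eq_or_ne x 0 with rfl | hx
  · have : (fun _ : {i // i ∈ C} => (0 : ℝ)) = 0 := rfl
    simp [this, energyNorm]
  · have : Nonempty n := by
      by_contra h
      rw [not_nonempty_iff] at h
      exact hx (Subsingleton.elim _ _)
    have h := (isGreatest_muHat hA C P).2 ⟨x, hx, rfl⟩
    rwa [div_le_iff₀ (pow_pos (l2Norm_mulVec_pos hA hx) 2), l2Norm_sq] at h

end MuHat

/-! ### Optimal interpolation -/

section Optimal

variable {n : Type u} [Fintype n] [DecidableEq n]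

lemma sum_blocks (C : Finset n) (f : n → ℝ) :
    ∑ i, f i = ∑ i : {i // i ∉ C}, f i + ∑ i : {i // i ∈ C}, f i := by
  rw [add_comm]
  convert (Fintype.sum_subtype_add_sum_subtype (· ∈ C) f).symm

lemma blockFF_sq (C : Finset n) (A : Matrix n n ℝ) :
    blockFF C (A ^ 2) = blockFF C A ^ 2 + blockFC C A * blockCF C A := by
  ext i j
  simp only [blockFF, blockFC, blockCF, sq, Matrix.submatrix_apply, Matrix.add_apply,
    Matrix.mul_apply]
  exact sum_blocks C _

lemma blockFC_sq (C : Finset n) (A : Matrix n n ℝ) :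
    blockFC C (A ^ 2) = blockFF C A * blockFC C A + blockFC C A * blockCC C A := by
  ext i j
  simp only [blockFF, blockFC, blockCC, sq, Matrix.submatrix_apply, Matrix.add_apply,
    Matrix.mul_apply]
  exact sum_blocks C _

omit [Fintype n] [DecidableEq n] in
lemma posDef_blockFF {B : Matrix n n ℝ} (hB : B.PosDef) (C : Finset n) : (blockFF C B).PosDef :=
  hB.submatrix Subtype.val_injective

/-- The range of ideal interpolation for `B` is `B`-orthogonal to the vectors that vanish on the
C-points. -/
lemma dotProduct_mulVec_idealInterpolation {B : Matrix n n ℝ} (hB : B.PosDef) (C : Finset n)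
    {f : n → ℝ} (hf : ∀ j ∈ C, f j = 0) (v : {i // i ∈ C} → ℝ) :
    f ⬝ᵥ (B *ᵥ (idealInterpolation C B *ᵥ v)) = 0 := by
  have hU : IsUnit (blockFF C B).det :=
    (Matrix.isUnit_iff_isUnit_det _).1 (posDef_blockFF hB C).isUnit
  set W := -((blockFF C B)⁻¹ * blockFC C B) with hW
  have key : blockFF C B *ᵥ (W *ᵥ v) + blockFC C B *ᵥ v = 0 := by
    rw [Matrix.mulVec_mulVec, hW, Matrix.mul_neg, ← Matrix.mul_assoc, Matrix.mul_nonsing_inv _ hU,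
      Matrix.one_mul, Matrix.neg_mulVec, neg_add_cancel]
  rw [dotProduct]
  refine Finset.sum_eq_zero fun i _ => ?_
  by_cases hi : i ∈ C
  · rw [hf i hi, zero_mul]
  · have h : (B *ᵥ (interpolation C W *ᵥ v)) i =
        (blockFF C B *ᵥ (W *ᵥ v) + blockFC C B *ᵥ v) ⟨i, hi⟩ := by
      simp only [Matrix.mulVec, dotProduct, Pi.add_apply, blockFF, blockFC,
        Matrix.submatrix_apply]
      rw [sum_blocks C]
      congr 1
      · refine Finset.sum_congr rfl fun k _ => ?_
        congr 1
        exact interpolation_apply_notMem C W v k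
      · refine Finset.sum_congr rfl fun k _ => ?_
        congr 1
        exact interpolation_apply_mem C W v k
    rw [idealInterpolation, ← hW, h, key]
    simp

lemma quadForm_sq {A : Matrix n n ℝ} (hA : A.PosDef) (x y : n → ℝ) :
    x ⬝ᵥ ((A ^ 2) *ᵥ y) = (A *ᵥ x) ⬝ᵥ (A *ᵥ y) := by
  rw [sq, ← Matrix.mulVec_mulVec, hA.isHermitian.dotProduct_mulVec_comm, dotProduct_comm]

lemma posDef_sq {A : Matrix n n ℝ} (hA : A.PosDef) : (A ^ 2).PosDef := by
  refine .of_dotProduct_mulVec_pos (hA.isHermitian.pow 2) fun x hx => ?_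
  rw [star_trivial, quadForm_sq hA, ← l2Norm_sq]
  exact pow_pos (l2Norm_mulVec_pos hA hx) 2

/-- The error `f = u - P u_c` of ideal interpolation for `A²` vanishes on the C-points. It is thus
its own error for every other `[W; I]`, while by orthogonality `‖A f‖ ≤ ‖A u‖`. -/
lemma muHat_idealInterpolation_sq_le [Nonempty n] {A : Matrix n n ℝ} (hA : A.PosDef)
    (C : Finset n) (W : Matrix {i // i ∉ C} {i // i ∈ C} ℝ) :
    muHat A C (idealInterpolation C (A ^ 2)) ≤ muHat A C (interpolation C W) := by
  refine csSup_le (isGreatest_muHat hA C _).nonempty ?_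
  rintro _ ⟨u, hu, rfl⟩
  rw [div_le_iff₀ (pow_pos (l2Norm_mulVec_pos hA hu) 2), l2Norm_sq]
  set g := idealInterpolation C (A ^ 2) *ᵥ (fun j : {i // i ∈ C} => u j) with hg
  have hfC : ∀ j ∈ C, (u - g) j = 0 := fun j hj => by
    rw [Pi.sub_apply, hg, idealInterpolation, interpolation_apply_mem C _ _ ⟨j, hj⟩, sub_self]
  have h1 := energy_le_muHat hA C (interpolation C W) (u - g)
  have h0 : (fun j : {i // i ∈ C} => (u - g) j) = 0 := funext fun j => hfC j j.2
  rw [h0, Matrix.mulVec_zero, sub_zero] at h1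
  refine h1.trans (mul_le_mul_of_nonneg_left ?_ (muHat_nonneg _ _ _))
  have horth : (A *ᵥ (u - g)) ⬝ᵥ (A *ᵥ g) = 0 := by
    rw [← quadForm_sq hA]
    exact dotProduct_mulVec_idealInterpolation (posDef_sq hA) C hfC _
  have hsplit : A *ᵥ u = A *ᵥ (u - g) + A *ᵥ g := by
    rw [← Matrix.mulVec_add, sub_add_cancel]
  rw [hsplit, add_dotProduct, dotProduct_add, dotProduct_add, dotProduct_comm (A *ᵥ g), horth,
    ← l2Norm_sq (A *ᵥ g)]
  nlinarith [sq_nonneg (l2Norm (A *ᵥ g))]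

end Optimal

/-! ### One level of the V-cycle -/

section Level

variable {n : Type u} [Fintype n] [DecidableEq n]

lemma isUnit_det_of_posDef_symm {A M : Matrix n n ℝ} (hA : A.PosDef)
    (hS : (M + Mᵀ - A).PosDef) : IsUnit M.det := by
  refine (Matrix.isUnit_iff_isUnit_det _).1 (Matrix.mulVec_injective_iff_isUnit.1 ?_)
  refine (injective_iff_map_eq_zero (Matrix.mulVecLin M)).2 fun x hx => ?_
  by_contra h0
  have hx' : M *ᵥ x = 0 := hx
  have h1 := hS.quadForm_pos h0
  have h2 := hA.quadForm_pos h0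
  rw [Matrix.sub_mulVec, Matrix.add_mulVec, Matrix.mulVec_transpose, dotProduct_sub,
    dotProduct_add, dotProduct_comm x (x ᵥ* M), ← Matrix.dotProduct_mulVec, hx'] at h1
  simp at h1
  linarith

/-- If `B S⁻¹ Bᵀ ≤ c I`, then `Bᵀ B ≤ c S`. -/
lemma dotProduct_self_mulVec_le {B S : Matrix n n ℝ} {c : ℝ} (hS : S.PosDef)
    (hB : ∀ y : n → ℝ, y ⬝ᵥ ((B * S⁻¹ * Bᵀ) *ᵥ y) ≤ c * (y ⬝ᵥ y)) (w : n → ℝ) :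
    (B *ᵥ w) ⬝ᵥ (B *ᵥ w) ≤ c * (w ⬝ᵥ (S *ᵥ w)) := by
  have hU : IsUnit S.det := (Matrix.isUnit_iff_isUnit_det _).1 hS.isUnit
  set y := B *ᵥ w with hy
  set z := S⁻¹ *ᵥ (Bᵀ *ᵥ y) with hz
  have hSz : S *ᵥ z = Bᵀ *ᵥ y := by
    rw [hz, Matrix.mulVec_mulVec, Matrix.mul_nonsing_inv _ hU, Matrix.one_mulVec]
  have h1 : w ⬝ᵥ (S *ᵥ z) = y ⬝ᵥ y := by
    rw [hSz, Matrix.mulVec_transpose, dotProduct_comm, ← Matrix.dotProduct_mulVec]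
  have h2 : z ⬝ᵥ (S *ᵥ z) ≤ c * (y ⬝ᵥ y) := by
    refine le_trans (le_of_eq ?_) (hB y)
    rw [hSz, ← Matrix.mulVec_mulVec, ← Matrix.mulVec_mulVec, ← hz, Matrix.mulVec_transpose,
      dotProduct_comm, ← Matrix.dotProduct_mulVec]
  have hcs := hS.posSemidef.sq_dotProduct_mulVec_le w z
  rw [h1] at hcs
  have hw := hS.posSemidef.quadForm_nonneg w
  have hy0 : 0 ≤ y ⬝ᵥ y := by rw [← l2Norm_sq]; positivity
  have hle := hcs.trans (mul_le_mul_of_nonneg_left h2 hw)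
  rcases hy0.eq_or_lt with h0 | h0
  · -- The sign of `c` is not known a priori; it follows from `hB` unless `w = 0`.
    rcases eq_or_ne w 0 with rfl | hw0
    · simp [hy]
    · have hc : 0 ≤ c := by
        have hn := hB w
        have hp : 0 ≤ w ⬝ᵥ ((B * S⁻¹ * Bᵀ) *ᵥ w) := by
          have := hS.inv.posSemidef.mul_mul_conjTranspose_same B
          rw [Matrix.conjTranspose_eq_transpose_of_trivial] at this
          exact this.quadForm_nonneg w
        rw [← l2Norm_sq] at hn
        exact nonneg_of_mul_nonneg_left (hp.trans hn) (pow_pos (l2Norm_pos hw0) 2)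
      rw [← h0]
      positivity
  · refine le_of_mul_le_mul_left (a := y ⬝ᵥ y) ?_ h0
    rw [sq] at hle
    linarith

/-- With `S = M + Mᵀ - A` one has `(M - A) S⁻¹ (M - A)ᵀ = (S - Mᵀ) S⁻¹ (S - M) = M̃ - A ≤ M̃`. -/
lemma residual_le_symmetrizedSmoother {A M : Matrix n n ℝ} (hA : A.PosDef)
    (hS : (M + Mᵀ - A).PosDef) (w : n → ℝ) :
    ((M - A) *ᵥ w) ⬝ᵥ ((M - A) *ᵥ w) ≤
      spectralNorm2 (symmetrizedSmoother A M) * (w ⬝ᵥ ((M + Mᵀ - A) *ᵥ w)) := by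
  have hU : IsUnit (M + Mᵀ - A).det := (Matrix.isUnit_iff_isUnit_det _).1 hS.isUnit
  have hAt : Aᵀ = A := by simpa using hA.isHermitian.eq
  refine dotProduct_self_mulVec_le hS (fun y => ?_) w
  have hid : (M - A) * (M + Mᵀ - A)⁻¹ * (M - A)ᵀ = symmetrizedSmoother A M - A := by
    have h1 : M - A = (M + Mᵀ - A) - Mᵀ := by abel
    have h2 : (M - A)ᵀ = (M + Mᵀ - A) - M := by
      rw [Matrix.transpose_sub, hAt]; abel
    rw [h2, h1, symmetrizedSmoother]
    set S := M + Mᵀ - A with hSdef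
    rw [sub_mul, Matrix.mul_nonsing_inv _ hU, mul_sub, sub_mul, sub_mul, one_mul, one_mul,
      Matrix.nonsing_inv_mul_cancel_right _ _ hU]
    rw [hSdef]
    abel
  rw [hid, Matrix.sub_mulVec, dotProduct_sub]
  have := hA.posSemidef.quadForm_nonneg y
  have := dotProduct_mulVec_le_spectralNorm2 (symmetrizedSmoother A M) y
  linarith

/-- With `N = M - A` one has `N² ≤ ‖M‖ N` because `0 ≤ N ≤ M`, and `N ≤ M + Mᵀ - A = M + N`. -/
lemma residual_le_spectralNorm2 {A M : Matrix n n ℝ} (hA : A.PosDef) (hM : M.PosDef)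
    (hN : (M - A).PosSemidef) (w : n → ℝ) :
    ((M - A) *ᵥ w) ⬝ᵥ ((M - A) *ᵥ w) ≤
      spectralNorm2 M * (w ⬝ᵥ ((M + Mᵀ - A) *ᵥ w)) := by
  have hMt : Mᵀ = M := by simpa using hM.isHermitian.eq
  set y := (M - A) *ᵥ w with hy
  have hcs := hN.sq_dotProduct_mulVec_le y w
  rw [← hy] at hcs
  have h1 : y ⬝ᵥ ((M - A) *ᵥ y) ≤ spectralNorm2 M * (y ⬝ᵥ y) := by
    rw [Matrix.sub_mulVec, dotProduct_sub]
    have := hA.posSemidef.quadForm_nonneg y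
    have := dotProduct_mulVec_le_spectralNorm2 M y
    linarith
  have h2 : w ⬝ᵥ y ≤ w ⬝ᵥ ((M + Mᵀ - A) *ᵥ w) := by
    rw [hMt, add_sub_assoc, Matrix.add_mulVec, dotProduct_add]
    have := hM.posSemidef.quadForm_nonneg w
    linarith
  have hw : 0 ≤ w ⬝ᵥ y := hN.quadForm_nonneg w
  have hs := spectralNorm2_nonneg M
  have hy0 : 0 ≤ y ⬝ᵥ y := by rw [← l2Norm_sq]; positivity
  rcases hy0.eq_or_lt with h0 | h0
  · rw [← h0]
    exact mul_nonneg hs (hw.trans h2)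
  · refine le_of_mul_le_mul_left (a := y ⬝ᵥ y) ?_ h0
    have := hcs.trans (mul_le_mul h1 h2 hw (mul_nonneg hs hy0))
    linarith

omit [DecidableEq n] in
/-- The energy lost by one relaxation step `x ↦ e = x - w`, where `M w = A x`. -/
lemma energy_relax {A M : Matrix n n ℝ} (hA : A.PosDef) {x w : n → ℝ}
    (hw : M *ᵥ w = A *ᵥ x) :
    (x - w) ⬝ᵥ (A *ᵥ (x - w)) = x ⬝ᵥ (A *ᵥ x) - w ⬝ᵥ ((M + Mᵀ - A) *ᵥ w) := by
  have h1 : w ⬝ᵥ (Mᵀ *ᵥ w) = w ⬝ᵥ (M *ᵥ w) := by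
    rw [Matrix.mulVec_transpose, dotProduct_comm, ← Matrix.dotProduct_mulVec]
  simp only [Matrix.mulVec_sub, Matrix.sub_mulVec, Matrix.add_mulVec, dotProduct_sub,
    sub_dotProduct, dotProduct_add, h1, hw]
  rw [hA.isHermitian.dotProduct_mulVec_comm x w]
  ring

variable {m : Type u} [Fintype m] [DecidableEq m]

omit [DecidableEq n] [DecidableEq m] in
/-- The pair `e`, `y` with `A_c y = Pᵀ A e` describes the `A`-orthogonal projection `P y` of `e`
onto the range of `P`; this is the Pythagorean theorem for it. -/
lemma energy_sub_mulVec {A : Matrix n n ℝ} (hA : A.PosDef) {P : Matrix n m ℝ} {e : n → ℝ}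
    {y : m → ℝ} (hy : (Pᵀ * A * P) *ᵥ y = Pᵀ *ᵥ (A *ᵥ e)) (v : m → ℝ) :
    (e - P *ᵥ v) ⬝ᵥ (A *ᵥ (e - P *ᵥ v)) =
      e ⬝ᵥ (A *ᵥ e) - y ⬝ᵥ ((Pᵀ * A * P) *ᵥ y) +
        (v - y) ⬝ᵥ ((Pᵀ * A * P) *ᵥ (v - y)) := by
  have hp : ∀ (a : m → ℝ) (b : n → ℝ), (P *ᵥ a) ⬝ᵥ b = a ⬝ᵥ (Pᵀ *ᵥ b) := fun a b => by
    rw [Matrix.mulVec_transpose, dotProduct_comm a, ← Matrix.dotProduct_mulVec, dotProduct_comm]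
  have hAc : (Pᵀ * A * P).IsHermitian := by
    have := Matrix.isHermitian_conjTranspose_mul_mul P hA.isHermitian
    rwa [Matrix.conjTranspose_eq_transpose_of_trivial] at this
  have hv : (P *ᵥ v) ⬝ᵥ (A *ᵥ (P *ᵥ v)) = v ⬝ᵥ ((Pᵀ * A * P) *ᵥ v) := by
    rw [hp, Matrix.mulVec_mulVec, Matrix.mulVec_mulVec, Matrix.mul_assoc]
  have hve : (P *ᵥ v) ⬝ᵥ (A *ᵥ e) = v ⬝ᵥ ((Pᵀ * A * P) *ᵥ y) := by rw [hp, hy]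
  have hs := hAc.dotProduct_mulVec_comm y v
  simp only [Matrix.mulVec_sub, dotProduct_sub, sub_dotProduct, hv, hve,
    hA.isHermitian.dotProduct_mulVec_comm e (P *ᵥ v), hs]
  ring

/-- With `R = A_c⁻¹ Pᵀ A` and `G = I - M⁻¹ A`, the matrix `A E` is a congruence transform of
`A - Rᵀ (A_c - A_c E_c) R`. -/
lemma mul_cycle_eq {A : Matrix n n ℝ} (hA : Aᵀ = A) (M : Matrix n n ℝ) (P : Matrix n m ℝ)
    (Ec : Matrix m m ℝ) (hU : IsUnit (Pᵀ * A * P).det) :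
    A * ((1 - (Mᵀ)⁻¹ * A) * (1 - P * ((1 - Ec) * (Pᵀ * A * P)⁻¹) * Pᵀ * A) * (1 - M⁻¹ * A)) =
      (1 - M⁻¹ * A)ᵀ * (A - ((Pᵀ * A * P)⁻¹ * Pᵀ * A)ᵀ * (Pᵀ * A * P - Pᵀ * A * P * Ec) *
        ((Pᵀ * A * P)⁻¹ * Pᵀ * A)) * (1 - M⁻¹ * A) := by
  have hAct : (Pᵀ * A * P)ᵀ = Pᵀ * A * P := by
    simp [Matrix.transpose_mul, hA, Matrix.mul_assoc]
  have hG : (1 - M⁻¹ * A)ᵀ * A = A * (1 - (Mᵀ)⁻¹ * A) := by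
    rw [Matrix.transpose_sub, Matrix.transpose_mul, hA, Matrix.transpose_nonsing_inv]
    simp [sub_mul, mul_sub, Matrix.mul_assoc]
  have hR : ((Pᵀ * A * P)⁻¹ * Pᵀ * A)ᵀ * (Pᵀ * A * P - Pᵀ * A * P * Ec) = A * P * (1 - Ec) := by
    rw [Matrix.transpose_mul, Matrix.transpose_mul, Matrix.transpose_transpose, hA,
      Matrix.transpose_nonsing_inv, hAct]
    generalize Pᵀ * A * P = K at hU
    have : K - K * Ec = K * (1 - Ec) := by rw [mul_sub, mul_one]
    rw [this, Matrix.mul_assoc A, Matrix.mul_assoc P, ← Matrix.mul_assoc _ K,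
      Matrix.nonsing_inv_mul _ hU, Matrix.one_mul, Matrix.mul_assoc]
  rw [hR, ← Matrix.mul_assoc, ← Matrix.mul_assoc, ← hG, Matrix.mul_assoc _ A]
  congr 2
  rw [mul_sub, mul_one]
  simp only [Matrix.mul_assoc]

/-- The induction step: if `0 ≤ A_c E_c ≤ d A_c` with `d = c / (1 + c)`, and if coarse-grid
correction after relaxation satisfies `‖T e‖_A² ≤ c (‖x‖_A² - ‖e‖_A²)`, where `e = (I - M⁻¹ A) x`
and `T` is the `A`-orthogonal projection along the range of `P`, then `0 ≤ A E ≤ d A`. -/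
lemma cycle_bounds {A M : Matrix n n ℝ} (hA : A.PosDef) (hM : IsUnit M.det) {P : Matrix n m ℝ}
    {Ec : Matrix m m ℝ} {c : ℝ} (hc : 0 ≤ c) (hAc : (Pᵀ * A * P).PosDef)
    (hQ : (Pᵀ * A * P * Ec).PosSemidef)
    (hQd : ((c / (1 + c)) • (Pᵀ * A * P) - Pᵀ * A * P * Ec).PosSemidef)
    (hT : ∀ w : n → ℝ, ∀ e : n → ℝ, A *ᵥ e = (M - A) *ᵥ w → ∃ v : m → ℝ,
      (e - P *ᵥ v) ⬝ᵥ (A *ᵥ (e - P *ᵥ v)) ≤ c * (w ⬝ᵥ ((M + Mᵀ - A) *ᵥ w))) :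
    let E := (1 - (Mᵀ)⁻¹ * A) * (1 - P * ((1 - Ec) * (Pᵀ * A * P)⁻¹) * Pᵀ * A) * (1 - M⁻¹ * A)
    (A * E).PosSemidef ∧ ((c / (1 + c)) • A - A * E).PosSemidef := by
  intro E
  have hAt : Aᵀ = A := by simpa using hA.isHermitian.eq
  have hU : IsUnit (Pᵀ * A * P).det := (Matrix.isUnit_iff_isUnit_det _).1 hAc.isUnit
  have hE : A * E = (1 - M⁻¹ * A)ᵀ * (A - ((Pᵀ * A * P)⁻¹ * Pᵀ * A)ᵀ *
      (Pᵀ * A * P - Pᵀ * A * P * Ec) * ((Pᵀ * A * P)⁻¹ * Pᵀ * A)) * (1 - M⁻¹ * A) :=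
    mul_cycle_eq hAt M P Ec hU
  set d := c / (1 + c) with hd
  set G := 1 - M⁻¹ * A with hGdef
  set Ac := Pᵀ * A * P with hAcdef
  set R := Ac⁻¹ * Pᵀ * A with hRdef
  clear_value E G R
  have hherm : (A * E).IsHermitian := by
    rw [hE]
    have h1 : (Ac - Ac * Ec).IsHermitian := hAc.isHermitian.sub hQ.isHermitian
    have h2 := Matrix.isHermitian_conjTranspose_mul_mul R h1
    have h3 := Matrix.isHermitian_conjTranspose_mul_mul G (hA.isHermitian.sub h2)
    simpa only [Matrix.conjTranspose_eq_transpose_of_trivial] using h3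
  have hform : ∀ x : n → ℝ, x ⬝ᵥ ((A * E) *ᵥ x) =
      (G *ᵥ x) ⬝ᵥ (A *ᵥ (G *ᵥ x)) - (R *ᵥ (G *ᵥ x)) ⬝ᵥ (Ac *ᵥ (R *ᵥ (G *ᵥ x))) +
        (R *ᵥ (G *ᵥ x)) ⬝ᵥ ((Ac * Ec) *ᵥ (R *ᵥ (G *ᵥ x))) := fun x => by
    have hp : ∀ {p q : Type u} [Fintype p] [Fintype q] (B : Matrix p q ℝ) (a : q → ℝ) (b : p → ℝ),
        a ⬝ᵥ (Bᵀ *ᵥ b) = (B *ᵥ a) ⬝ᵥ b := fun B a b => by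
      rw [Matrix.mulVec_transpose, dotProduct_comm a, ← Matrix.dotProduct_mulVec, dotProduct_comm]
    rw [hE, ← Matrix.mulVec_mulVec, ← Matrix.mulVec_mulVec, hp, Matrix.sub_mulVec,
      ← Matrix.mulVec_mulVec, ← Matrix.mulVec_mulVec, dotProduct_sub, hp, Matrix.sub_mulVec,
      dotProduct_sub]
    ring
  have hy : ∀ e : n → ℝ, Ac *ᵥ (R *ᵥ e) = Pᵀ *ᵥ (A *ᵥ e) := fun e => by
    rw [Matrix.mulVec_mulVec, hRdef, Matrix.mul_assoc Ac⁻¹, Matrix.mul_nonsing_inv_cancel_left _ _ hU,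
      Matrix.mulVec_mulVec]
  refine ⟨.of_dotProduct_mulVec_nonneg hherm fun x => ?_,
    .of_dotProduct_mulVec_nonneg ((hA.isHermitian.smul (IsSelfAdjoint.all d)).sub hherm)
      fun x => ?_⟩
  · rw [star_trivial, hform]
    have h1 := energy_sub_mulVec hA (hy (G *ᵥ x)) (R *ᵥ (G *ᵥ x))
    rw [← hAcdef, sub_self, zero_dotProduct, add_zero] at h1
    rw [← h1]
    exact add_nonneg (hA.posSemidef.quadForm_nonneg _) (hQ.quadForm_nonneg _)
  · rw [star_trivial, Matrix.sub_mulVec, Matrix.smul_mulVec, dotProduct_sub, dotProduct_smul,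
      smul_eq_mul, hform]
    set w := M⁻¹ *ᵥ (A *ᵥ x) with hw
    have hMw : M *ᵥ w = A *ᵥ x := by
      rw [hw, Matrix.mulVec_mulVec, Matrix.mul_nonsing_inv _ hM, Matrix.one_mulVec]
    have hGx : G *ᵥ x = x - w := by
      rw [hGdef, Matrix.sub_mulVec, Matrix.one_mulVec, ← Matrix.mulVec_mulVec]
    have hen := energy_relax hA hMw
    rw [← hGx] at hen
    set e := G *ᵥ x with he
    set y := R *ᵥ e with hydef
    obtain ⟨v, hv⟩ := hT w e (by rw [hGx, Matrix.mulVec_sub, Matrix.sub_mulVec, hMw])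
    rw [energy_sub_mulVec hA (hy e) v] at hv
    have h2 := hAc.posSemidef.quadForm_nonneg (v - y)
    have h3 := hQd.quadForm_nonneg y
    rw [Matrix.sub_mulVec, Matrix.smul_mulVec, dotProduct_sub, dotProduct_smul, smul_eq_mul] at h3
    have hd1 : 1 - d = 1 / (1 + c) := by rw [hd]; field_simp; ring
    have hd2 : (1 - d) * c = d := by rw [hd1, hd]; ring
    have hd3 : 0 ≤ 1 - d := by rw [hd1]; positivity
    have h4 : e ⬝ᵥ (A *ᵥ e) - y ⬝ᵥ (Ac *ᵥ y) ≤ c * (w ⬝ᵥ ((M + Mᵀ - A) *ᵥ w)) := by linarith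
    have h5 := mul_le_mul_of_nonneg_left h4 hd3
    rw [← mul_assoc, hd2] at h5
    have h6 : d * (w ⬝ᵥ ((M + Mᵀ - A) *ᵥ w)) =
        d * (x ⬝ᵥ (A *ᵥ x)) - d * (e ⬝ᵥ (A *ᵥ e)) := by rw [hen]; ring
    linarith

end Level

/-! ### The multigrid hierarchy -/

namespace Hierarchy

/-- On every level but the coarsest, `M_ℓ + M_ℓᵀ - A_ℓ` is SPD and
`μ̂_{A_ℓ}(P_ℓ) ‖(M_ℓ - A_ℓ) w‖² ≤ c wᵀ (M_ℓ + M_ℓᵀ - A_ℓ) w` for all `w`. As `(M - A) w = A e` for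
the error `e` left by relaxation, this combines the approximation property of the interpolation
with the smoothing property of the relaxation. -/
def SmoothingBound (c : ℝ) : {n : Type u} → [Fintype n] → [DecidableEq n] → Hierarchy n →
    Matrix n n ℝ → Prop
  | _, _, _, coarsest, _ => True
  | _, _, _, level C W M next, A =>
      ((M + Mᵀ - A).PosDef ∧ ∀ w, muHat A C (interpolation C W) *
        (((M - A) *ᵥ w) ⬝ᵥ ((M - A) *ᵥ w)) ≤ c * (w ⬝ᵥ ((M + Mᵀ - A) *ᵥ w))) ∧
      SmoothingBound c next (galerkin A C W)

lemma maxMuHat_nonneg {n : Type u} [Fintype n] [DecidableEq n] (H : Hierarchy n)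
    (A : Matrix n n ℝ) : 0 ≤ H.maxMuHat A := by
  cases H with
  | coarsest => exact le_rfl
  | level C W M next =>
    exact le_max_of_le_left (mul_nonneg (muHat_nonneg _ _ _) (spectralNorm2_nonneg _))

lemma maxMuHatSymm_nonneg {n : Type u} [Fintype n] [DecidableEq n] (H : Hierarchy n)
    (A : Matrix n n ℝ) : 0 ≤ H.maxMuHatSymm A := by
  cases H with
  | coarsest => exact le_rfl
  | level C W M next =>
    exact le_max_of_le_left (mul_nonneg (muHat_nonneg _ _ _) (spectralNorm2_nonneg _))

lemma ConvergentSmoothers.smoothingBound {c : ℝ} : ∀ {n : Type u} [Fintype n] [DecidableEq n]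
    {H : Hierarchy n} {A : Matrix n n ℝ} (_ : A.PosDef) (_ : H.ConvergentSmoothers A)
    (_ : H.maxMuHatSymm A ≤ c), H.SmoothingBound c A
  | _, _, _, .coarsest, _, _, _, _ => trivial
  | _, _, _, .level C W M next, A, hA, h, hc => by
    obtain ⟨hS, hnext⟩ := h
    obtain ⟨hc1, hc2⟩ := max_le_iff.1 hc
    refine ⟨⟨hS, fun w => ?_⟩, smoothingBound (posDef_galerkin hA C W) hnext hc2⟩
    refine (mul_le_mul_of_nonneg_left (residual_le_symmetrizedSmoother hA hS w)
      (muHat_nonneg _ _ _)).trans ?_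
    rw [← mul_assoc]
    exact mul_le_mul_of_nonneg_right hc1 (hS.posSemidef.quadForm_nonneg w)

lemma ScaledSPDSmoothers.smoothingBound {c : ℝ} : ∀ {n : Type u} [Fintype n] [DecidableEq n]
    {H : Hierarchy n} {A : Matrix n n ℝ} (_ : A.PosDef) (_ : H.ScaledSPDSmoothers A)
    (_ : H.maxMuHat A ≤ c), H.SmoothingBound c A
  | _, _, _, .coarsest, _, _, _, _ => trivial
  | _, _, _, .level C W M next, A, hA, h, hc => by
    obtain ⟨⟨hM, hN⟩, hnext⟩ := h
    obtain ⟨hc1, hc2⟩ := max_le_iff.1 hc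
    have hMt : Mᵀ = M := by simpa using hM.isHermitian.eq
    have hS : (M + Mᵀ - A).PosDef := by
      rw [hMt, add_sub_assoc]
      exact hM.add_posSemidef hN
    refine ⟨⟨hS, fun w => ?_⟩, smoothingBound (posDef_galerkin hA C W) hnext hc2⟩
    refine (mul_le_mul_of_nonneg_left (residual_le_spectralNorm2 hA hM hN w)
      (muHat_nonneg _ _ _)).trans ?_
    rw [← mul_assoc]
    exact mul_le_mul_of_nonneg_right hc1 (hS.posSemidef.quadForm_nonneg w)

lemma SmoothingBound.errorMG_bounds {c : ℝ} (hc : 0 ≤ c) :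
    ∀ {n : Type u} [Fintype n] [DecidableEq n] {H : Hierarchy n} {A : Matrix n n ℝ}
    (_ : A.PosDef) (_ : H.SmoothingBound c A),
    (A * H.errorMG A).PosSemidef ∧ ((c / (1 + c)) • A - A * H.errorMG A).PosSemidef
  | _, _, _, .coarsest, A, hA, _ => by
    simp only [errorMG, mul_zero, sub_zero]
    exact ⟨.zero, hA.posSemidef.smul (a := c / (1 + c)) (by positivity)⟩
  | _, _, _, .level C W M next, A, hA, h => by
    obtain ⟨⟨hS, hb⟩, hnext⟩ := h
    have hAc := posDef_galerkin hA C W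
    obtain ⟨hQ, hQd⟩ := errorMG_bounds hc hAc hnext
    refine cycle_bounds hA (isUnit_det_of_posDef_symm hA hS) hc hAc hQ hQd fun w e he =>
      ⟨fun j => e j, ?_⟩
    rw [← energyNorm_sq hA.posSemidef]
    refine (energy_le_muHat hA C _ e).trans ?_
    rw [he]
    exact hb w

lemma SmoothingBound.KMG_bounds {n : Type u} [Fintype n] [DecidableEq n]
    {H : Hierarchy n} {A : Matrix n n ℝ} {c : ℝ} (hc : 0 ≤ c) (hA : A.PosDef)
    (h : H.SmoothingBound c A) :
    energyOpNorm A (H.errorMG A) < 1 ∧ 1 ≤ H.KMG A ∧ H.KMG A ≤ 1 + c := by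
  obtain ⟨hQ, hQd⟩ := h.errorMG_bounds hc hA
  have h0 := energyOpNorm_nonneg A (H.errorMG A)
  have h1 := energyOpNorm_le (by positivity) hA hQ hQd
  have hd : c / (1 + c) = 1 - 1 / (1 + c) := by field_simp; ring
  have hpos : 0 < 1 / (1 + c) := by positivity
  have hlt : 0 < 1 - energyOpNorm A (H.errorMG A) := by linarith
  refine ⟨by linarith, ?_, ?_⟩
  · rw [KMG, one_le_div hlt]
    linarith
  · rw [KMG, one_div_le hlt (by positivity)]
    linarith

end Hierarchy

theorem mainTheorem2 {n : Type u} [Fintype n] [DecidableEq n] [Nonempty n]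
    (A : Matrix n n ℝ) (hA : A.PosDef) :
    -- the maximum in the definition of `μ̂(P)` is attained
    (∀ (C : Finset n) (W : Matrix {i // i ∉ C} {i // i ∈ C} ℝ),
      IsGreatest (muHatSet A C (interpolation C W)) (muHat A C (interpolation C W))) ∧
    -- multigrid convergence, for all hierarchies and smoothers
    (∀ H : Hierarchy n,
      (H.ConvergentSmoothers A →
        energyOpNorm A (H.errorMG A) < 1 ∧ 1 ≤ H.KMG A ∧ H.KMG A ≤ 1 + H.maxMuHatSymm A) ∧
      (H.ScaledSPDSmoothers A →
        energyOpNorm A (H.errorMG A) < 1 ∧ 1 ≤ H.KMG A ∧ H.KMG A ≤ 1 + H.maxMuHat A)) ∧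
    -- the minimum of `μ̂` over all `P = [W; I]` is attained by ideal interpolation for `A²`
    (∀ C : Finset n,
      IsUnit (blockFF C A ^ 2 + blockFC C A * blockCF C A).det ∧
      interpolation C (-((blockFF C A ^ 2 + blockFC C A * blockCF C A)⁻¹ *
          (blockFF C A * blockFC C A + blockFC C A * blockCC C A))) =
        idealInterpolation C (A ^ 2) ∧
      ∀ W : Matrix {i // i ∉ C} {i // i ∈ C} ℝ,
        muHat A C (interpolation C (-((blockFF C A ^ 2 + blockFC C A * blockCF C A)⁻¹ *
          (blockFF C A * blockFC C A + blockFC C A * blockCC C A)))) ≤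
        muHat A C (interpolation C W)) := by
  refine ⟨fun C W => isGreatest_muHat hA C _, fun H => ⟨fun h => ?_, fun h => ?_⟩, fun C => ?_⟩
  · exact (h.smoothingBound hA le_rfl).KMG_bounds (H.maxMuHatSymm_nonneg A) hA
  · exact (h.smoothingBound hA le_rfl).KMG_bounds (H.maxMuHat_nonneg A) hA
  · rw [← blockFF_sq, ← blockFC_sq]
    exact ⟨(Matrix.isUnit_iff_isUnit_det _).1 (posDef_blockFF (posDef_sq hA) C).isUnit, rfl,
      muHat_idealInterpolation_sq_le hA C⟩
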